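/- Let $D\subset\mathbb C^2$ be a bounded convex domain with $\mathcal C^{1,1}$-smooth boundary (near each boundary point, $D$ is given as $\{\rho<0\}$ for a $\mathcal C^1$ function $\rho$ with Lipschitz, nowhere vanishing gradient). Suppose that there is a neighborhood $U$ of $0$ with $$D\cap U=\{z=(z_1,z_2)\in U:\ -\operatorname{Re} z_1+\psi(|z_2|)<0\},$$ where $\psi$ is a nonnegative convex function of class $\mathcal C^{1,1}$ on a neighborhood of $0$ in $\mathbb R$ such that $\psi(0)=0$ and $$\limsup_{x\to 0}\frac{\log\psi(|x|)}{\log|x|}=\infty$$ (with $\log 0=-\infty$, so that the quotient is $+\infty$ where $\psi(|x|)=0$, $0<|x|<1$). Let $\mathbb D$ be the unit disc, let $$l_D(z,w)=\inf\{\tanh^{-1}|\alpha|:\ \alpha\in\mathbb D,\ \exists\,\varphi:\mathbb D\to D\text{ holomorphic with }\varphi(0)=z,\ \varphi(\alpha)=w\}$$ be the Lempert function of $D$, and let the Kobayashi distance $k_D$ be the largest pseudodistance on $D$ not exceeding $l_D$. Then $(D,k_D)$ is not Gromov hyperbolic, i.e., with $(x,y)_z=k_D(x,z)+k_D(z,y)-k_D(x,y)$,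 $$\sup_{p,q,x,w\in D}\Big(\min\{(p,x)_w,(x,q)_w\}-(p,q)_w\Big)=\infty .$$ -/

import Mathlib

open Set Filter Topology
open scoped ENNReal NNReal

/-- `f` is of class `C^{1,1}` on the (open) set `U`: it is `C^1` there and its derivative is
Lipschitz on `U`. -/
def IsC11On {E : Type*} [NormedAddCommGroup E] [NormedSpace ℝ E] (f : E → ℝ) (U : Set E) : Prop :=
  ContDiffOn ℝ 1 f U ∧ ∃ K : ℝ≥0, LipschitzOnWith K (fderiv ℝ f) U

/-- The open set `D` has `C^{1,1}`-smooth boundary: near every boundary point it is the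
sublevel set `{ρ < 0}` of a `C^{1,1}` function whose derivative does not vanish. -/
def HasC11Boundary {E : Type*} [NormedAddCommGroup E] [NormedSpace ℝ E] (D : Set E) : Prop :=
  ∀ p ∈ frontier D, ∃ (U : Set E) (ρ : E → ℝ), IsOpen U ∧ p ∈ U ∧ IsC11On ρ U ∧
    (∀ z ∈ U, fderiv ℝ ρ z ≠ 0) ∧ D ∩ U = {z ∈ U | ρ z < 0}

section Kobayashi

variable {E : Type*} [NormedAddCommGroup E] [NormedSpace ℂ E]

/-- The Lempert function of `D`: the infimum of `tanh⁻¹ |α|` over all holomorphic maps `φ` of the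
unit disc into `D` with `φ 0 = z` and `φ α = w` (and `∞` if there are none). -/
noncomputable def lempertFun (D : Set E) (z w : E) : ℝ≥0∞ :=
  sInf {r | ∃ (φ : ℂ → E) (α : ℂ), DifferentiableOn ℂ φ (Metric.ball 0 1) ∧
    MapsTo φ (Metric.ball 0 1) D ∧ α ∈ Metric.ball (0 : ℂ) 1 ∧ φ 0 = z ∧ φ α = w ∧
    r = ENNReal.ofReal (Real.artanh ‖α‖)}

/-- `d` restricts to an (extended) pseudodistance on `D`. -/
structure IsPseudodistOn (D : Set E) (d : E → E → ℝ≥0∞) : Prop where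
  self : ∀ x ∈ D, d x x = 0
  symm : ∀ x ∈ D, ∀ y ∈ D, d x y = d y x
  triangle : ∀ x ∈ D, ∀ y ∈ D, ∀ z ∈ D, d x z ≤ d x y + d y z

/-- The Kobayashi pseudodistance of `D`, with values in `[0, ∞]`: the largest pseudodistance on `D`
that does not exceed the Lempert function. It is finite if `D` is open and connected. -/
noncomputable def kobayashiEDist (D : Set E) (z w : E) : ℝ≥0∞ :=
  sSup {r | ∃ d : E → E → ℝ≥0∞, IsPseudodistOn D d ∧
    (∀ x ∈ D, ∀ y ∈ D, d x y ≤ lempertFun D x y) ∧ r = d z w}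

/-- The Kobayashi distance of a domain `D`, as a real number. -/
noncomputable def kobayashiDist (D : Set E) (z w : E) : ℝ :=
  (kobayashiEDist D z w).toReal

end Kobayashi

/-- The Gromov product `(x, y)_z` (normalized without the factor `1/2`). -/
def gromovProd {X : Type*} (d : X → X → ℝ) (x y z : X) : ℝ :=
  d x z + d z y - d x y

/-- `(D, d)` is Gromov hyperbolic: `min {(p, x)_w, (x, q)_w} - (p, q)_w` is bounded above for
`p, q, x, w` in `D`. -/
def IsGromovHyperbolicOn {X : Type*} (D : Set X) (d : X → X → ℝ) : Prop :=
  ∃ C : ℝ, ∀ p ∈ D, ∀ q ∈ D, ∀ x ∈ D, ∀ w ∈ D,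
    min (gromovProd d p x w) (gromovProd d x q w) - gromovProd d p q w ≤ C

/-- `ψ` vanishes to infinite order at `0`: `limsup_{x → 0} log ψ(|x|) / log |x| = ∞`. The quotient
is taken in the extended reals, with `log 0 = -∞`, so that it is `+∞` where `ψ(|x|) = 0` and
`0 < |x| < 1`. -/
def VanishesToInfiniteOrder (ψ : ℝ → ℝ) : Prop :=
  limsup (fun x : ℝ => ENNReal.log (ENNReal.ofReal (ψ |x|)) / ((Real.log |x| : ℝ) : EReal))
    (𝓝[≠] 0) = ⊤

/-!
Suppose that, in coordinates `(ζ, η) ↦ ζ • u + η • v`, the domain contains a large part of the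
product of the right half-plane and the unit disc, and that two holomorphic functions with positive
real part separate points of the two factors almost as well as the hyperbolic metrics do. Then the
Kobayashi distance between points of this part is, up to a bounded error, the maximum of the
hyperbolic distances of the coordinates. Hence the points with hyperbolic coordinates `(-t, t)`,
`(t, t)`, `(0, 0)` and `(0, 2 * t)` form an `ℓ^∞`-square whose sides are close to `t` and whose
diagonals are close to `2 * t`, and the four-point condition fails as `t → ∞`.

Such almost products exist near `0`. If `ψ` vanishes on an interval, the complex line `z₁ = 0` meets
`closure D` in a convex set with `0` in its interior. The second factor is its largest disc around
`0`, controlled by a half-space that contains `D` and almost touches this disc. Otherwise the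
infinite order of `ψ` yields points `x` with `x * deriv ψ x` much larger than `ψ x`, and the
half-space tangent to `D` at `(ψ x, x)` controls the second factor.
-/

section KobayashiBounds

variable {E : Type*} [NormedAddCommGroup E] [NormedSpace ℂ E] {D : Set E} {x y z : E}

theorem kobayashiEDist_comm (hx : x ∈ D) (hy : y ∈ D) :
    kobayashiEDist D x y = kobayashiEDist D y x := by
  unfold kobayashiEDist
  congr 1
  ext r
  constructor <;> rintro ⟨d, hd, hle, rfl⟩
  · exact ⟨d, hd, hle, hd.symm x hx y hy⟩
  · exact ⟨d, hd, hle, hd.symm y hy x hx⟩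

theorem kobayashiDist_comm (hx : x ∈ D) (hy : y ∈ D) :
    kobayashiDist D x y = kobayashiDist D y x :=
  congrArg ENNReal.toReal (kobayashiEDist_comm hx hy)

theorem IsPseudodistOn.le_kobayashiEDist {d : E → E → ℝ≥0∞} (hd : IsPseudodistOn D d)
    (hle : ∀ x ∈ D, ∀ y ∈ D, d x y ≤ lempertFun D x y) (x y : E) : d x y ≤ kobayashiEDist D x y :=
  le_sSup ⟨d, hd, hle, rfl⟩

theorem kobayashiEDist_triangle (hx : x ∈ D) (hy : y ∈ D) (hz : z ∈ D) :
    kobayashiEDist D x z ≤ kobayashiEDist D x y + kobayashiEDist D y z := by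
  refine sSup_le ?_
  rintro r ⟨d, hd, hle, rfl⟩
  exact (hd.triangle x hx y hy z hz).trans
    (add_le_add (hd.le_kobayashiEDist hle x y) (hd.le_kobayashiEDist hle y z))

theorem kobayashiEDist_ne_top_of_common_neighbor (hx : x ∈ D) (hy : y ∈ D) (hz : z ∈ D)
    (hxy : kobayashiEDist D x y ≠ ∞) (hyz : kobayashiEDist D y z ≠ ∞) :
    kobayashiEDist D x z ≠ ∞ :=
  ne_top_of_le_ne_top (ENNReal.add_ne_top.2 ⟨hxy, hyz⟩) (kobayashiEDist_triangle hx hy hz)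

theorem kobayashiEDist_le_lempertFun (hx : x ∈ D) (hy : y ∈ D) :
    kobayashiEDist D x y ≤ lempertFun D x y := by
  refine sSup_le ?_
  rintro r ⟨d, -, hle, rfl⟩
  exact hle x hx y hy

theorem kobayashiEDist_le_of_mapsTo_ball {φ : ℂ → E} {s : ℝ} {α : ℂ} (hα : ‖α‖ < s)
    (hφ : DifferentiableOn ℂ φ (Metric.ball 0 s)) (hmaps : MapsTo φ (Metric.ball 0 s) D) :
    kobayashiEDist D (φ 0) (φ α) ≤ ENNReal.ofReal (Real.artanh (‖α‖ / s)) := by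
  have hs : 0 < s := (norm_nonneg α).trans_lt hα
  have hs' : (s : ℂ) ≠ 0 := Complex.ofReal_ne_zero.2 hs.ne'
  have norm_s : ‖(s : ℂ)‖ = s := Complex.norm_of_nonneg hs.le
  have hscale : MapsTo (fun ζ : ℂ => s * ζ) (Metric.ball 0 1) (Metric.ball 0 s) := by
    intro ζ hζ
    rw [mem_ball_zero_iff] at hζ ⊢
    rw [norm_mul, norm_s]
    exact mul_lt_of_lt_one_right hs hζ
  have hlempert : lempertFun D (φ 0) (φ α) ≤ ENNReal.ofReal (Real.artanh (‖α‖ / s)) := by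
    refine sInf_le ⟨fun ζ => φ (s * ζ), α / s, hφ.comp (by fun_prop) hscale, hmaps.comp hscale,
      ?_, congrArg φ (mul_zero _), congrArg φ (mul_div_cancel₀ _ hs'), by rw [norm_div, norm_s]⟩
    rw [mem_ball_zero_iff, norm_div, norm_s]
    exact (div_lt_one hs).2 hα
  exact (kobayashiEDist_le_lempertFun (hmaps (by simpa using hs))
    (hmaps (by simpa using hα))).trans hlempert

theorem sq_norm_add_conj (z w : ℂ) :
    ‖z + (starRingEnd ℂ) w‖ ^ 2 = ‖z - w‖ ^ 2 + 4 * z.re * w.re := by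
  simp only [Complex.sq_norm, Complex.normSq_apply, Complex.add_re, Complex.add_im,
    Complex.sub_re, Complex.sub_im, Complex.conj_re, Complex.conj_im]
  ring

theorem norm_sub_le_norm_mul_norm_add_conj_of_re_pos {f : ℂ → ℂ}
    (hf : DifferentiableOn ℂ f (Metric.ball 0 1))
    (hpos : ∀ ζ ∈ Metric.ball (0 : ℂ) 1, 0 < (f ζ).re) {α : ℂ} (hα : ‖α‖ < 1) :
    ‖f α - f 0‖ ≤ ‖α‖ * ‖f α + (starRingEnd ℂ) (f 0)‖ := by
  have h0 : 0 < (f 0).re := hpos 0 (Metric.mem_ball_self one_pos)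
  have hlt : ∀ ζ ∈ Metric.ball (0 : ℂ) 1, ‖f ζ - f 0‖ < ‖f ζ + (starRingEnd ℂ) (f 0)‖ := by
    intro ζ hζ
    refine lt_of_pow_lt_pow_left₀ 2 (norm_nonneg _) ?_
    rw [sq_norm_add_conj]
    have := mul_pos (hpos ζ hζ) h0
    linarith
  have hden : ∀ ζ ∈ Metric.ball (0 : ℂ) 1, 0 < ‖f ζ + (starRingEnd ℂ) (f 0)‖ :=
    fun ζ hζ => (norm_nonneg _).trans_lt (hlt ζ hζ)
  have schwarz : ‖(f α - f 0) / (f α + (starRingEnd ℂ) (f 0))‖ ≤ ‖α‖ := by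
    refine Complex.norm_le_norm_of_mapsTo_ball (R := 1)
      (f := fun ζ => (f ζ - f 0) / (f ζ + (starRingEnd ℂ) (f 0))) ?_ ?_ (by simp) hα
    · exact (hf.sub_const _).div (hf.add_const _) fun ζ hζ => norm_pos_iff.1 (hden ζ hζ)
    · intro ζ hζ
      rw [mem_closedBall_zero_iff, norm_div, div_le_one (hden ζ hζ)]
      exact (hlt ζ hζ).le
  rwa [norm_div, div_le_iff₀ (hden α (mem_ball_zero_iff.2 hα))] at schwarz

theorem abs_re_sub_re_le_of_norm_sub_le {z w : ℂ} {r : ℝ} (hz : 0 < z.re) (hw : 0 < w.re)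
    (hr0 : 0 ≤ r) (hr1 : r ≤ 1) (h : ‖z - w‖ ≤ r * ‖z + (starRingEnd ℂ) w‖) :
    |z.re - w.re| ≤ r * (z.re + w.re) := by
  have norm_sub_sq : ‖z - w‖ ^ 2 = (z.re - w.re) ^ 2 + (z.im - w.im) ^ 2 := by
    rw [Complex.sq_norm, Complex.normSq_apply, Complex.sub_re, Complex.sub_im]
    ring
  have hsq : ‖z - w‖ ^ 2 ≤ r ^ 2 * (‖z - w‖ ^ 2 + 4 * z.re * w.re) := by
    rw [← sq_norm_add_conj, ← mul_pow]
    exact pow_le_pow_left₀ (norm_nonneg _) h 2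
  have him : r ^ 2 * (z.im - w.im) ^ 2 ≤ (z.im - w.im) ^ 2 :=
    mul_le_of_le_one_left (sq_nonneg _) (pow_le_one₀ hr0 hr1)
  refine abs_le_of_sq_le_sq ?_ (by positivity)
  rw [norm_sub_sq] at hsq
  linarith

theorem artanh_sub_div_add {a b : ℝ} (ha : 0 < a) (hb : 0 < b) :
    Real.artanh ((b - a) / (b + a)) = (Real.log b - Real.log a) / 2 := by
  have hab : 0 < b + a := add_pos hb ha
  have hmem : (b - a) / (b + a) ∈ Icc (-1) 1 :=
    ⟨by rw [le_div_iff₀ hab]; linarith, by rw [div_le_iff₀ hab]; linarith⟩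
  rw [Real.artanh_eq_half_log hmem, one_add_div hab.ne', one_sub_div hab.ne',
    div_div_div_cancel_right₀ hab.ne', ← Real.log_div hb.ne' ha.ne']
  have : (b + a + (b - a)) / (b + a - (b - a)) = b / a := by
    rw [div_eq_div_iff (by linarith) ha.ne']
    ring
  rw [this]
  ring

theorem abs_log_sub_log_div_two_le_artanh {a b r : ℝ} (ha : 0 < a) (hb : 0 < b) (hr : r < 1)
    (h : |a - b| ≤ r * (a + b)) : |Real.log a - Real.log b| / 2 ≤ Real.artanh r := by
  wlog hab : a ≤ b generalizing a b
  · rw [abs_sub_comm]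
    exact this hb ha (by rwa [abs_sub_comm, add_comm]) (le_of_not_ge hab)
  have hsum : 0 < b + a := add_pos hb ha
  rw [abs_sub_comm, abs_of_nonneg (sub_nonneg.2 (Real.log_le_log ha hab)),
    ← artanh_sub_div_add ha hb]
  refine Real.artanh_le_artanh ?_ hr ?_
  · rw [lt_div_iff₀ hsum]
    linarith
  · rw [div_le_iff₀ hsum, add_comm b a]
    rw [abs_sub_comm] at h
    exact (le_abs_self _).trans h

theorem abs_log_re_sub_log_re_le_artanh {f : ℂ → ℂ} (hf : DifferentiableOn ℂ f (Metric.ball 0 1))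
    (hpos : ∀ ζ ∈ Metric.ball (0 : ℂ) 1, 0 < (f ζ).re) {α : ℂ} (hα : ‖α‖ < 1) :
    |Real.log (f α).re - Real.log (f 0).re| / 2 ≤ Real.artanh ‖α‖ := by
  have hα0 : 0 < (f α).re := hpos α (mem_ball_zero_iff.2 hα)
  have h0 : 0 < (f 0).re := hpos 0 (Metric.mem_ball_self one_pos)
  exact abs_log_sub_log_div_two_le_artanh hα0 h0 hα <|
    abs_re_sub_re_le_of_norm_sub_le hα0 h0 (norm_nonneg α) hα.le <|
      norm_sub_le_norm_mul_norm_add_conj_of_re_pos hf hpos hα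

theorem ofReal_abs_log_re_sub_log_re_le_kobayashiEDist {f : E → ℂ} (hf : DifferentiableOn ℂ f D)
    (hpos : ∀ z ∈ D, 0 < (f z).re) (x y : E) :
    ENNReal.ofReal (|Real.log (f x).re - Real.log (f y).re| / 2) ≤ kobayashiEDist D x y := by
  refine IsPseudodistOn.le_kobayashiEDist (D := D)
    (d := fun x y => ENNReal.ofReal (|Real.log (f x).re - Real.log (f y).re| / 2))
    ⟨?_, ?_, ?_⟩ ?_ x y
  · simp
  · simp only [abs_sub_comm, implies_true]
  · intro x _ y _ z _
    rw [← ENNReal.ofReal_add (by positivity) (by positivity)]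
    apply ENNReal.ofReal_le_ofReal
    linarith [abs_sub_le (Real.log (f x).re) (Real.log (f y).re) (Real.log (f z).re)]
  · intro x _ y _
    refine le_sInf ?_
    rintro r ⟨φ, α, hφ, hmaps, hα, rfl, rfl, rfl⟩
    rw [abs_sub_comm]
    exact ENNReal.ofReal_le_ofReal (abs_log_re_sub_log_re_le_artanh (hf.comp hφ hmaps)
      (fun ζ hζ => hpos _ (hmaps hζ)) (mem_ball_zero_iff.1 hα))

theorem abs_log_re_sub_log_re_le_kobayashiDist {f : E → ℂ} (hf : DifferentiableOn ℂ f D)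
    (hpos : ∀ z ∈ D, 0 < (f z).re) (hfin : kobayashiEDist D x y ≠ ∞) :
    |Real.log (f x).re - Real.log (f y).re| / 2 ≤ kobayashiDist D x y :=
  (ENNReal.ofReal_le_iff_le_toReal hfin).1
    (ofReal_abs_log_re_sub_log_re_le_kobayashiEDist hf hpos x y)

end KobayashiBounds

theorem add_sub_two_mul_le_of_fourPoint {X : Type*} {D : Set X} {d : X → X → ℝ} {C A B₁ B₂ : ℝ}
    (hsymm : ∀ x ∈ D, ∀ y ∈ D, d x y = d y x)
    (hC : ∀ p ∈ D, ∀ q ∈ D, ∀ x ∈ D, ∀ w ∈ D,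
      min (gromovProd d p x w) (gromovProd d x q w) - gromovProd d p q w ≤ C)
    {p q x w : X} (hp : p ∈ D) (hq : q ∈ D) (hx : x ∈ D) (hw : w ∈ D)
    (hpx : d p x ≤ A) (hxq : d x q ≤ A) (hpw : d p w ≤ A) (hwq : d w q ≤ A)
    (hpq : B₁ ≤ d p q) (hxw : B₂ ≤ d x w) : B₁ + B₂ - 2 * A ≤ C := by
  have h := hC p hp q hq x hx w hw
  rw [gromovProd, gromovProd, gromovProd, hsymm w hw x hx] at h
  rcases min_cases (d p w + d x w - d p x) (d x w + d w q - d x q) with ⟨hmin, -⟩ | ⟨hmin, -⟩ <;>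
    rw [hmin] at h <;> linarith

section Tanh

variable {s t x y : ℝ}

theorem tanh_add (x y : ℝ) : Real.tanh (x + y) =
    (Real.tanh x + Real.tanh y) / (1 + Real.tanh x * Real.tanh y) := by
  have hx := (Real.cosh_pos x).ne'
  have hy := (Real.cosh_pos y).ne'
  rw [Real.tanh_eq_sinh_div_cosh, Real.tanh_eq_sinh_div_cosh, Real.tanh_eq_sinh_div_cosh,
    Real.sinh_add, Real.cosh_add, div_add_div _ _ hx hy, div_mul_div_comm,
    one_add_div (mul_ne_zero hx hy), div_div_div_cancel_right₀ (mul_ne_zero hx hy)]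

theorem one_add_tanh_div_one_sub_tanh (t : ℝ) :
    (1 + Real.tanh t) / (1 - Real.tanh t) = Real.exp (2 * t) := by
  have hcosh := (Real.cosh_pos t).ne'
  rw [Real.tanh_eq_sinh_div_cosh, one_add_div hcosh, one_sub_div hcosh,
    div_div_div_cancel_right₀ hcosh, Real.cosh_add_sinh, Real.cosh_sub_sinh, ← Real.exp_sub]
  ring_nf

theorem exp_mul_one_sub_tanh_le (t : ℝ) : Real.exp (2 * t) * (1 - Real.tanh t) ≤ 2 := by
  have hlt : 0 < 1 - Real.tanh t := sub_pos.2 (Real.tanh_lt_one t)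
  rw [← one_add_tanh_div_one_sub_tanh, div_mul_cancel₀ _ hlt.ne']
  linarith

theorem tanh_pos (ht : 0 < t) : 0 < Real.tanh t := by
  rw [Real.tanh_eq_sinh_div_cosh]
  exact div_pos (Real.sinh_pos_iff.2 ht) (Real.cosh_pos t)

theorem tanh_lt_tanh (hxy : x < y) : Real.tanh x < Real.tanh y := by
  by_contra! h
  have := Real.artanh_le_artanh (Real.neg_one_lt_tanh y) (Real.tanh_lt_one x) h
  rw [Real.artanh_tanh, Real.artanh_tanh] at this
  exact hxy.not_ge this

theorem exists_artanh_tanh_div_eq_add_one (ht : 0 < t) :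
    ∃ s, Real.tanh t < s ∧ s < 1 ∧ Real.artanh (Real.tanh t / s) = t + 1 := by
  have hpos : 0 < Real.tanh t := tanh_pos ht
  have hlt : Real.tanh t < Real.tanh (t + 1) := tanh_lt_tanh (lt_add_one t)
  refine ⟨Real.tanh t / Real.tanh (t + 1), ?_, (div_lt_one (hpos.trans hlt)).2 hlt, ?_⟩
  · exact (lt_div_iff₀ (hpos.trans hlt)).2 (mul_lt_of_lt_one_right hpos (Real.tanh_lt_one _))
  · rw [div_div_cancel₀ hpos.ne', Real.artanh_tanh]

end Tanh

section UnitDisc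

variable {ζ : ℂ} {s κ : ℝ}

theorem one_sub_ne_zero_of_norm_lt_one (hζ : ‖ζ‖ < 1) : 1 - ζ ≠ 0 := by
  rw [sub_ne_zero]
  rintro rfl
  exact hζ.ne norm_one

theorem one_add_mul_ne_zero_of_norm_lt_one (hζ : ‖ζ‖ < 1) (hκ : |κ| ≤ 1) :
    1 + (κ : ℂ) * ζ ≠ 0 := by
  have hlt : ‖-((κ : ℂ) * ζ)‖ < 1 := by
    rw [norm_neg, norm_mul, Complex.norm_real]
    exact mul_lt_one_of_nonneg_of_lt_one_right hκ (norm_nonneg _) hζ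
  simpa only [sub_neg_eq_add] using one_sub_ne_zero_of_norm_lt_one hlt

theorem norm_cayley_le (hζ : ‖ζ‖ < s) (hs : s < 1) :
    ‖(1 + ζ) / (1 - ζ)‖ ≤ (1 + s) / (1 - s) := by
  have hadd : ‖1 + ζ‖ ≤ 1 + s := (norm_add_le _ _).trans (by rw [norm_one]; linarith)
  have hsub : 1 - s ≤ ‖1 - ζ‖ := by
    have := norm_sub_norm_le (1 : ℂ) ζ
    rw [norm_one] at this
    linarith
  rw [norm_div]
  exact div_le_div₀ (by linarith [norm_nonneg ζ]) hadd (by linarith) hsub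

theorem re_cayley (ζ : ℂ) : ((1 + ζ) / (1 - ζ)).re = (1 - ‖ζ‖ ^ 2) / ‖1 - ζ‖ ^ 2 := by
  rw [Complex.div_re, ← add_div, Complex.sq_norm, Complex.sq_norm, Complex.normSq_apply ζ]
  simp only [Complex.add_re, Complex.sub_re, Complex.one_re, Complex.add_im, Complex.sub_im,
    Complex.one_im]
  ring

theorem inv_le_re_cayley (hζ : ‖ζ‖ < s) (hs : s < 1) :
    ((1 + s) / (1 - s))⁻¹ ≤ ((1 + ζ) / (1 - ζ)).re := by
  have hs0 : 0 < s := (norm_nonneg ζ).trans_lt hζ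
  have hne := one_sub_ne_zero_of_norm_lt_one (hζ.trans hs)
  have hsub : ‖1 - ζ‖ ≤ 1 + s := (norm_sub_le _ _).trans (by rw [norm_one]; linarith)
  calc ((1 + s) / (1 - s))⁻¹ = (1 - s ^ 2) / (1 + s) ^ 2 := by
        rw [inv_div, div_eq_div_iff (by positivity) (by positivity)]
        ring
    _ ≤ (1 - ‖ζ‖ ^ 2) / ‖1 - ζ‖ ^ 2 := by
        have : ‖ζ‖ ^ 2 ≤ s ^ 2 := pow_le_pow_left₀ (norm_nonneg _) hζ.le 2
        have : s ^ 2 < 1 := pow_lt_one₀ hs0.le hs two_ne_zero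
        exact div_le_div₀ (by linarith) (by linarith) (pow_pos (norm_pos_iff.2 hne) 2)
          (pow_le_pow_left₀ (norm_nonneg _) hsub 2)
    _ = ((1 + ζ) / (1 - ζ)).re := (re_cayley ζ).symm

theorem norm_mobius_lt_one (hζ : ‖ζ‖ < 1) (hκ : |κ| < 1) : ‖(ζ + κ) / (1 + κ * ζ)‖ < 1 := by
  have hne := one_add_mul_ne_zero_of_norm_lt_one hζ hκ.le
  have sq_norm_sub_sq_norm : ‖1 + κ * ζ‖ ^ 2 - ‖ζ + κ‖ ^ 2 = (1 - ‖ζ‖ ^ 2) * (1 - |κ| ^ 2) := by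
    simp only [Complex.sq_norm, Complex.normSq_apply, Complex.add_re, Complex.add_im,
      Complex.ofReal_re, Complex.ofReal_im, Complex.one_re, Complex.one_im, Complex.mul_re,
      Complex.mul_im, sq_abs]
    ring
  have hpos : 0 < (1 - ‖ζ‖ ^ 2) * (1 - |κ| ^ 2) :=
    mul_pos (sub_pos.2 (pow_lt_one₀ (norm_nonneg _) hζ two_ne_zero))
      (sub_pos.2 (pow_lt_one₀ (abs_nonneg _) hκ two_ne_zero))
  rw [norm_div, div_lt_one (norm_pos_iff.2 hne)]
  exact lt_of_pow_lt_pow_left₀ 2 (norm_nonneg _) (by linarith)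

end UnitDisc

section AlmostProduct

variable {E : Type*} [NormedAddCommGroup E] [NormedSpace ℂ E] {D : Set E} {u v : E}
  {M s t α β : ℝ}

/-- `D` contains the product of a truncated right half-plane and the unit disc, in the coordinates
`(ζ, η) ↦ ζ • u + η • v`; the half-plane is truncated to `M⁻¹ ≤ re ζ`, `‖ζ‖ ≤ M`. -/
def ContainsTruncatedProduct (D : Set E) (M : ℝ) (u v : E) : Prop :=
  ∀ ζ η : ℂ, M⁻¹ ≤ ζ.re → ‖ζ‖ ≤ M → ‖η‖ < 1 → ζ • u + η • v ∈ D

/-- The point whose coordinates `(ζ, η)` lie on the geodesics `(0, ∞)` of the half-plane and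
`(-1, 1)` of the disc, at the signed hyperbolic distances `α` from `1` and `β` from `0`. -/
noncomputable def productPoint (u v : E) (α β : ℝ) : E :=
  (Real.exp (2 * α) : ℂ) • u + (Real.tanh β : ℂ) • v

/-- The graph of a Möbius map of the disc over a Cayley transform: a holomorphic disc along which
both coordinates of `productPoint u v α β` move at unit speed. -/
noncomputable def productDisc (u v : E) (α β : ℝ) (ζ : ℂ) : E :=
  (Real.exp (2 * α) * ((1 + ζ) / (1 - ζ))) • u +
    ((ζ + Real.tanh β) / (1 + Real.tanh β * ζ)) • v

theorem ContainsTruncatedProduct.neg (h : ContainsTruncatedProduct D M u v) :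
    ContainsTruncatedProduct D M u (-v) := by
  intro ζ η hre hζ hη
  rw [smul_neg, ← neg_smul]
  exact h ζ (-η) hre hζ (by rwa [norm_neg])

theorem productPoint_neg (u v : E) (α β : ℝ) :
    productPoint u (-v) α β = productPoint u v α (-β) := by
  rw [productPoint, productPoint, Real.tanh_neg, Complex.ofReal_neg, smul_neg, neg_smul]

theorem productPoint_zero_left (u v : E) (β : ℝ) :
    productPoint u v 0 β = u + (Real.tanh β : ℂ) • v := by
  rw [productPoint, mul_zero, Real.exp_zero, Complex.ofReal_one, one_smul]

theorem productDisc_tanh (u v : E) (α β t : ℝ) :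
    productDisc u v α β (Real.tanh t) = productPoint u v (α + t) (β + t) := by
  rw [productDisc, productPoint, mul_add, Real.exp_add, ← one_add_tanh_div_one_sub_tanh t,
    add_comm β t, tanh_add t β, mul_comm (Real.tanh t) (Real.tanh β)]
  push_cast
  rfl

theorem productDisc_zero (u v : E) (α β : ℝ) : productDisc u v α β 0 = productPoint u v α β := by
  simpa using productDisc_tanh u v α β 0

theorem differentiableOn_productDisc (u v : E) (α β : ℝ) :
    DifferentiableOn ℂ (productDisc u v α β) (Metric.ball 0 1) := by
  refine (DifferentiableOn.smul_const (.const_mul (.div (by fun_prop) (by fun_prop) ?_) _) _).add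
    (DifferentiableOn.smul_const (.div (by fun_prop) (by fun_prop) ?_) _)
  · exact fun ζ hζ => one_sub_ne_zero_of_norm_lt_one (mem_ball_zero_iff.1 hζ)
  · exact fun ζ hζ => one_add_mul_ne_zero_of_norm_lt_one (mem_ball_zero_iff.1 hζ)
      (Real.abs_tanh_lt_one β).le

theorem ContainsTruncatedProduct.mapsTo_productDisc (h : ContainsTruncatedProduct D M u v)
    (hs : s < 1) (hM : Real.exp (2 * |α|) * ((1 + s) / (1 - s)) ≤ M) (β : ℝ) :
    MapsTo (productDisc u v α β) (Metric.ball 0 s) D := by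
  intro ζ hζ
  rw [mem_ball_zero_iff] at hζ
  have hs0 : 0 < s := (norm_nonneg ζ).trans_lt hζ
  have : 0 < (1 + s) / (1 - s) := div_pos (by linarith) (by linarith)
  refine h _ _ ?_ ?_ (norm_mobius_lt_one (hζ.trans hs) (Real.abs_tanh_lt_one β))
  · rw [Complex.re_ofReal_mul]
    calc M⁻¹ ≤ (Real.exp (2 * |α|) * ((1 + s) / (1 - s)))⁻¹ := by gcongr
      _ = Real.exp (-(2 * |α|)) * ((1 + s) / (1 - s))⁻¹ := by rw [mul_inv, Real.exp_neg]
      _ ≤ Real.exp (2 * α) * ((1 + ζ) / (1 - ζ)).re := by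
          gcongr
          · linarith [neg_abs_le α]
          · exact inv_le_re_cayley hζ hs
  · rw [norm_mul, Complex.norm_real, Real.norm_eq_abs, Real.abs_exp]
    refine le_trans ?_ hM
    gcongr
    · exact le_abs_self α
    · exact norm_cayley_le hζ hs

theorem ContainsTruncatedProduct.kobayashiEDist_add_add_le (h : ContainsTruncatedProduct D M u v)
    (ht : 0 < t) (hts : Real.tanh t < s) (hs : s < 1)
    (hM : Real.exp (2 * |α|) * ((1 + s) / (1 - s)) ≤ M) (β : ℝ) :
    kobayashiEDist D (productPoint u v α β) (productPoint u v (α + t) (β + t)) ≤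
      ENNReal.ofReal (Real.artanh (Real.tanh t / s)) := by
  have norm_tanh : ‖(Real.tanh t : ℂ)‖ = Real.tanh t := Complex.norm_of_nonneg (tanh_pos ht).le
  have := kobayashiEDist_le_of_mapsTo_ball (α := Real.tanh t) (by rwa [norm_tanh])
    ((differentiableOn_productDisc u v α β).mono (Metric.ball_subset_ball hs.le))
    (h.mapsTo_productDisc hs hM β)
  rwa [productDisc_zero, productDisc_tanh, norm_tanh] at this

theorem ContainsTruncatedProduct.kobayashiEDist_add_sub_le (h : ContainsTruncatedProduct D M u v)
    (ht : 0 < t) (hts : Real.tanh t < s) (hs : s < 1)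
    (hM : Real.exp (2 * |α|) * ((1 + s) / (1 - s)) ≤ M) (β : ℝ) :
    kobayashiEDist D (productPoint u v α β) (productPoint u v (α + t) (β - t)) ≤
      ENNReal.ofReal (Real.artanh (Real.tanh t / s)) := by
  have := h.neg.kobayashiEDist_add_add_le ht hts hs hM (-β)
  rwa [productPoint_neg, productPoint_neg, neg_neg, neg_add, neg_neg, ← sub_eq_add_neg] at this

theorem ContainsTruncatedProduct.productPoint_mem (h : ContainsTruncatedProduct D M u v)
    (hs0 : 0 < s) (hs : s < 1) (hM : Real.exp (2 * |α|) * ((1 + s) / (1 - s)) ≤ M) (β : ℝ) :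
    productPoint u v α β ∈ D := by
  rw [← productDisc_zero]
  exact h.mapsTo_productDisc hs hM β (Metric.mem_ball_self hs0)

theorem re_apply_productPoint {f : E →L[ℂ] ℂ} (hv : f v = 0) (α β : ℝ) :
    (f (productPoint u v α β)).re = Real.exp (2 * α) * (f u).re := by
  rw [productPoint, map_add, map_smul, map_smul, hv, smul_zero, add_zero, smul_eq_mul,
    Complex.re_ofReal_mul]

theorem abs_sub_le_kobayashiDist_productPoint {f : E →L[ℂ] ℂ} (hv : f v = 0)
    (hpos : ∀ z ∈ D, 0 < (f z).re) {α' β' : ℝ} (hmem : productPoint u v α β ∈ D)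
    (hfin : kobayashiEDist D (productPoint u v α β) (productPoint u v α' β') ≠ ∞) :
    |α - α'| ≤ kobayashiDist D (productPoint u v α β) (productPoint u v α' β') := by
  have hu : 0 < (f u).re := by
    have := hpos _ hmem
    rw [re_apply_productPoint hv] at this
    exact pos_of_mul_pos_right this (Real.exp_nonneg _)
  refine le_of_eq_of_le ?_
    (abs_log_re_sub_log_re_le_kobayashiDist f.differentiable.differentiableOn hpos hfin)
  rw [re_apply_productPoint hv, re_apply_productPoint hv, Real.log_mul (Real.exp_ne_zero _) hu.ne',
    Real.log_mul (Real.exp_ne_zero _) hu.ne', Real.log_exp, Real.log_exp, add_sub_add_right_eq_sub,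
    ← mul_sub, abs_mul, abs_two, mul_div_cancel_left₀ _ two_ne_zero]

/-- In the coordinates `(ζ, η) ↦ ζ • u + η • v` the domain contains a truncated product of a
half-plane and a disc, while the values of the outer functions `f` and `g` separate points of the
two factors almost as well as the hyperbolic metrics do; `g` has to do so only up to the
hyperbolic distance `2 * t` from the centre of the disc. -/
structure IsAlmostProduct (D : Set E) (f g : E → ℂ) (u v : E) (t M : ℝ) : Prop where
  apply_eq_zero : f v = 0
  containsTruncatedProduct : ContainsTruncatedProduct D M u v
  differentiableOn : DifferentiableOn ℂ g D
  re_pos : ∀ z ∈ D, 0 < (g z).re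
  exp_mul_re_le : Real.exp (4 * t) * (g (u + (Real.tanh (2 * t) : ℂ) • v)).re ≤ 3 * (g u).re

theorem IsAlmostProduct.le_kobayashiDist {f g : E → ℂ} (h : IsAlmostProduct D f g u v t M)
    (hx : productPoint u v 0 0 ∈ D) (hw : productPoint u v 0 (2 * t) ∈ D)
    (hfin : kobayashiEDist D (productPoint u v 0 0) (productPoint u v 0 (2 * t)) ≠ ∞) :
    2 * t - Real.log 3 / 2 ≤
      kobayashiDist D (productPoint u v 0 0) (productPoint u v 0 (2 * t)) := by
  refine le_trans ?_ (abs_log_re_sub_log_re_le_kobayashiDist h.differentiableOn h.re_pos hfin)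
  have hx_pos := h.re_pos _ hx
  have hw_pos := h.re_pos _ hw
  simp only [productPoint_zero_left, Real.tanh_zero, Complex.ofReal_zero, zero_smul,
    add_zero] at hx_pos hw_pos ⊢
  have hlog := Real.log_le_log (mul_pos (Real.exp_pos _) hw_pos) h.exp_mul_re_le
  rw [Real.log_mul (Real.exp_ne_zero _) hw_pos.ne', Real.log_exp,
    Real.log_mul three_ne_zero hx_pos.ne'] at hlog
  have := le_abs_self (Real.log (g u).re - Real.log (g (u + (Real.tanh (2 * t) : ℂ) • v)).re)
  linarith

theorem exists_forall_kobayashiEDist_productPoint_le (E : Type*) [NormedAddCommGroup E]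
    [NormedSpace ℂ E] (ht : 0 < t) :
    ∃ M : ℝ, 1 < M ∧ ∀ (D : Set E) (u v : E), ContainsTruncatedProduct D M u v →
      ∀ α β : ℝ, |α| ≤ t → productPoint u v α β ∈ D ∧
        kobayashiEDist D (productPoint u v α β) (productPoint u v (α + t) (β + t)) ≤
          ENNReal.ofReal (t + 1) ∧
        kobayashiEDist D (productPoint u v α β) (productPoint u v (α + t) (β - t)) ≤
          ENNReal.ofReal (t + 1) := by
  obtain ⟨s, hts, hs, hs_eq⟩ := exists_artanh_tanh_div_eq_add_one ht
  have hs0 : 0 < s := (tanh_pos ht).trans hts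
  have one_lt_exp : 1 < Real.exp (2 * t) := Real.one_lt_exp_iff.2 (by positivity)
  have one_le_cayley : 1 ≤ (1 + s) / (1 - s) := (one_le_div (by linarith)).2 (by linarith)
  refine ⟨Real.exp (2 * t) * ((1 + s) / (1 - s)), one_lt_mul_of_lt_of_le one_lt_exp one_le_cayley,
    fun D u v h α β hα => ?_⟩
  have hM : Real.exp (2 * |α|) * ((1 + s) / (1 - s)) ≤ Real.exp (2 * t) * ((1 + s) / (1 - s)) := by
    gcongr
  rw [← hs_eq]
  exact ⟨h.productPoint_mem hs0 hs hM β, h.kobayashiEDist_add_add_le ht hts hs hM β,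
    h.kobayashiEDist_add_sub_le ht hts hs hM β⟩

theorem IsAlmostProduct.le_of_fourPoint {f : E →L[ℂ] ℂ} {g : E → ℂ} {C : ℝ}
    (h : IsAlmostProduct D f g u v t M) (hf : ∀ z ∈ D, 0 < (f z).re) (ht : 0 < t)
    (hmoves : ∀ α β : ℝ, |α| ≤ t → productPoint u v α β ∈ D ∧
      kobayashiEDist D (productPoint u v α β) (productPoint u v (α + t) (β + t)) ≤
        ENNReal.ofReal (t + 1) ∧
      kobayashiEDist D (productPoint u v α β) (productPoint u v (α + t) (β - t)) ≤
        ENNReal.ofReal (t + 1))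
    (hC : ∀ p ∈ D, ∀ q ∈ D, ∀ x ∈ D, ∀ w ∈ D,
      min (gromovProd (kobayashiDist D) p x w) (gromovProd (kobayashiDist D) x q w) -
        gromovProd (kobayashiDist D) p q w ≤ C) :
    2 * t - Real.log 3 / 2 - 2 ≤ C := by
  have h0 : |(0 : ℝ)| ≤ t := by rw [abs_zero]; exact ht.le
  have hneg : |-t| ≤ t := by rw [abs_neg, abs_of_pos ht]
  obtain ⟨hp, hpw, hpx⟩ := hmoves (-t) t hneg
  obtain ⟨hx, hxq, -⟩ := hmoves 0 0 h0
  obtain ⟨hw, -, hwq⟩ := hmoves 0 (2 * t) h0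
  obtain ⟨hq, -⟩ := hmoves t t (abs_of_pos ht).le
  rw [neg_add_cancel, sub_self] at hpx
  rw [zero_add] at hxq
  rw [neg_add_cancel, ← two_mul] at hpw
  rw [zero_add, two_mul, add_sub_cancel_right, ← two_mul] at hwq
  have hfin : ∀ {a b : E}, kobayashiEDist D a b ≤ ENNReal.ofReal (t + 1) →
      kobayashiEDist D a b ≠ ∞ := ne_top_of_le_ne_top ENNReal.ofReal_ne_top
  have hpq := abs_sub_le_kobayashiDist_productPoint h.apply_eq_zero hf hp
    (kobayashiEDist_ne_top_of_common_neighbor hp hx hq (hfin hpx) (hfin hxq))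
  have hxw := h.le_kobayashiDist hx hw (kobayashiEDist_ne_top_of_common_neighbor hx hp hw
    (kobayashiEDist_comm hx hp ▸ hfin hpx) (hfin hpw))
  have ht1 : 0 ≤ t + 1 := by linarith
  have := add_sub_two_mul_le_of_fourPoint (fun _ ha _ hb => kobayashiDist_comm ha hb) hC
    hp hq hx hw (ENNReal.toReal_le_of_le_ofReal ht1 hpx) (ENNReal.toReal_le_of_le_ofReal ht1 hxq)
    (ENNReal.toReal_le_of_le_ofReal ht1 hpw) (ENNReal.toReal_le_of_le_ofReal ht1 hwq) hpq hxw
  linarith [neg_le_abs (-t - t)]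

theorem not_isGromovHyperbolicOn_of_isAlmostProduct {f : E →L[ℂ] ℂ} (hf : ∀ z ∈ D, 0 < (f z).re)
    (h : ∀ t M : ℝ, 0 < t → 1 < M → ∃ (g : E → ℂ) (u v : E), IsAlmostProduct D f g u v t M) :
    ¬ IsGromovHyperbolicOn D (kobayashiDist D) := by
  rintro ⟨C, hC⟩
  have : 0 < Real.log 3 := Real.log_pos (by norm_num)
  have ht : 0 < |C| + Real.log 3 / 2 + 2 := by positivity
  obtain ⟨M, hM, hmoves⟩ := exists_forall_kobayashiEDist_productPoint_le E ht
  obtain ⟨g, u, v, hguv⟩ := h _ M ht hM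
  have := hguv.le_of_fourPoint hf ht (hmoves D u v hguv.containsTruncatedProduct) hC
  linarith [le_abs_self C]

end AlmostProduct

section InfiniteOrder

variable {ψ ψ' : ℝ → ℝ} {S : Set ℝ} {ε a b c x y : ℝ} {N : ℕ}

theorem le_div_mul_of_convexOn_of_map_zero (hψ : ConvexOn ℝ (Ico 0 ε) ψ) (hψ0 : ψ 0 = 0)
    (hy : 0 ≤ y) (hyx : y ≤ x) (hx : 0 < x) (hxε : x < ε) : ψ y ≤ y / x * ψ x := by
  have := hψ.2 (left_mem_Ico.2 (hx.trans hxε)) ⟨hx.le, hxε⟩ (sub_nonneg.2 ((div_le_one hx).2 hyx))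
    (div_nonneg hy hx.le) (sub_add_cancel _ _)
  simpa only [smul_eq_mul, mul_zero, zero_add, hψ0, div_mul_cancel₀ y hx.ne'] using this

theorem le_of_convexOn_of_map_zero (hψ : ConvexOn ℝ (Ico 0 ε) ψ) (hψ0 : ψ 0 = 0)
    (hψx : 0 ≤ ψ x) (hy : 0 ≤ y) (hyx : y ≤ x) (hx : 0 < x) (hxε : x < ε) : ψ y ≤ ψ x :=
  (le_div_mul_of_convexOn_of_map_zero hψ hψ0 hy hyx hx hxε).trans
    (mul_le_of_le_one_left hψx ((div_le_one hx).2 hyx))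

theorem tendsto_nhdsGT_zero_of_convexOn (hε : 0 < ε) (hψ : ConvexOn ℝ (Ico 0 ε) ψ)
    (hψ_nonneg : ∀ x ∈ Ico 0 ε, 0 ≤ ψ x) (hψ0 : ψ 0 = 0) : Tendsto ψ (𝓝[>] 0) (𝓝 0) := by
  have hε2 : 0 < ε / 2 := half_pos hε
  have hev : ∀ᶠ y in 𝓝[>] (0 : ℝ), y ∈ Ioo 0 (ε / 2) := Ioo_mem_nhdsGT hε2
  have hline : Tendsto (fun y => y / (ε / 2) * ψ (ε / 2)) (𝓝[>] 0) (𝓝 0) :=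
    (Continuous.tendsto' (by fun_prop) 0 0 (by simp)).mono_left nhdsWithin_le_nhds
  refine tendsto_of_tendsto_of_tendsto_of_le_of_le' tendsto_const_nhds hline ?_ ?_
  · filter_upwards [hev] with y hy using hψ_nonneg y ⟨hy.1.le, hy.2.trans (half_lt_self hε)⟩
  · filter_upwards [hev] with y hy using
      le_div_mul_of_convexOn_of_map_zero hψ hψ0 hy.1.le hy.2.le hε2 (half_lt_self hε)

theorem add_rightDeriv_mul_sub_le (hψ : ConvexOn ℝ S ψ) (hx : x ∈ interior S) (hy : y ∈ S) :
    ψ x + derivWithin ψ (Ioi x) x * (y - x) ≤ ψ y := by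
  rcases lt_trichotomy x y with hxy | rfl | hyx
  · have := hψ.rightDeriv_le_slope_of_mem_interior hx hy hxy
    rw [slope_def_field, le_div_iff₀ (sub_pos.2 hxy)] at this
    linarith
  · simp
  · have := (hψ.slope_le_leftDeriv_of_mem_interior hy hx hyx).trans
      (hψ.leftDeriv_le_rightDeriv_of_mem_interior hx)
    rw [slope_def_field, div_le_iff₀ (sub_pos.2 hyx)] at this
    linarith

theorem le_mul_div_pow_of_mul_deriv_right_lt (ha : 0 < a) (hab : a ≤ b)
    (hψ : ContinuousOn ψ (Icc a b)) (hψ' : ∀ x ∈ Ico a b, HasDerivWithinAt ψ (ψ' x) (Ici x) x)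
    (hlt : ∀ x ∈ Ico a b, x * ψ' x < N * ψ x) : ψ b ≤ ψ a * (b / a) ^ N := by
  -- The comparison function `B x = ψ a * (x / a) ^ N` satisfies `x * deriv B x = N * B x`.
  have hB : ∀ x, HasDerivAt (fun x => ψ a * (x / a) ^ N)
      (ψ a * (N * (x / a) ^ (N - 1) * (1 / a))) x :=
    fun x => (((hasDerivAt_id' x).div_const a).pow N).const_mul (ψ a)
  refine image_le_of_deriv_right_lt_deriv_boundary' hψ hψ' ?_
    (fun x _ => (hB x).continuousAt.continuousWithinAt) (fun x _ => (hB x).hasDerivWithinAt) ?_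
    (right_mem_Icc.2 hab)
  · rw [div_self ha.ne', one_pow, mul_one]
  · intro x hx hψx
    have hx0 : 0 < x := ha.trans_le hx.1
    have euler : x * (ψ a * (N * (x / a) ^ (N - 1) * (1 / a))) = N * (ψ a * (x / a) ^ N) := by
      rcases eq_or_ne N 0 with rfl | hN
      · simp
      · rw [← mul_pow_sub_one hN (x / a)]
        ring
    refine lt_of_mul_lt_mul_left ?_ hx0.le
    rw [euler, ← hψx]
    exact hlt x hx

theorem not_vanishesToInfiniteOrder_of_eventually_pow_le (h : ∀ᶠ x in 𝓝[>] 0, x ^ N ≤ ψ x) :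
    ¬ VanishesToInfiniteOrder ψ := by
  intro hψ
  have habs : Tendsto (fun x : ℝ => |x|) (𝓝[≠] 0) (𝓝[>] 0) := tendsto_abs_nhdsNE_zero
  have hle : limsup (fun x : ℝ => ENNReal.log (ENNReal.ofReal (ψ |x|)) /
      ((Real.log |x| : ℝ) : EReal)) (𝓝[≠] 0) ≤ ((N : ℝ) : EReal) := by
    refine limsup_le_of_le (by isBoundedDefault) ?_
    filter_upwards [habs.eventually h, habs.eventually (Ioo_mem_nhdsGT one_pos)]
      with x hpow ⟨hx0, hx1⟩
    rw [ENNReal.log_ofReal_of_pos ((pow_pos hx0 N).trans_le hpow), ← EReal.coe_div,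
      EReal.coe_le_coe_iff, div_le_iff_of_neg (Real.log_neg hx0 hx1), ← Real.log_pow]
    exact Real.log_le_log (pow_pos hx0 N) hpow
  rw [hψ, top_le_iff] at hle
  exact EReal.coe_ne_top _ hle

theorem not_vanishesToInfiniteOrder_of_eventually_mul_pow_le (hc : 0 < c)
    (h : ∀ᶠ x in 𝓝[>] 0, c * x ^ N ≤ ψ x) : ¬ VanishesToInfiniteOrder ψ := by
  refine not_vanishesToInfiniteOrder_of_eventually_pow_le (N := N + 1) ?_
  filter_upwards [h, Ioo_mem_nhdsGT hc] with x hx ⟨hx0, hxc⟩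
  rw [pow_succ']
  exact (mul_le_mul_of_nonneg_right hxc.le (pow_nonneg hx0.le N)).trans hx

theorem pos_of_mul_rightDeriv_lt (hψ : ConvexOn ℝ (Ico 0 ε) ψ)
    (hψ_nonneg : ∀ x ∈ Ico 0 ε, 0 ≤ ψ x) (hψ0 : ψ 0 = 0) (hx : x ∈ Ioo 0 ε)
    (hlt : x * derivWithin ψ (Ioi x) x < N * ψ x) : 0 < ψ x := by
  have hsub := add_rightDeriv_mul_sub_le hψ (interior_Ico (a := (0 : ℝ)) ▸ hx)
    (left_mem_Ico.2 (hx.1.trans hx.2))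
  refine (hψ_nonneg x (Ioo_subset_Ico_self hx)).lt_of_ne fun h0 => ?_
  rw [← h0, mul_zero] at hlt
  rw [hψ0, ← h0] at hsub
  linarith

theorem VanishesToInfiniteOrder.frequently_mul_le_mul_rightDeriv (h : VanishesToInfiniteOrder ψ)
    (hε : 0 < ε) (hψ : ConvexOn ℝ (Ico 0 ε) ψ) (hψ_nonneg : ∀ x ∈ Ico 0 ε, 0 ≤ ψ x)
    (hψ0 : ψ 0 = 0) (N : ℕ) :
    ∃ᶠ x in 𝓝[>] 0, N * ψ x ≤ x * derivWithin ψ (Ioi x) x := by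
  intro hev
  simp only [not_le] at hev
  obtain ⟨b, hb0, hb⟩ := (mem_nhdsGT_iff_exists_Ioc_subset).1
    (inter_mem hev (Ioo_mem_nhdsGT hε))
  have hint : ∀ x ∈ Ioc 0 b, x ∈ interior (Ico 0 ε) := fun x hx =>
    interior_Ico (a := (0 : ℝ)) ▸ (hb hx).2
  have hb' : b ∈ Ioc 0 b := right_mem_Ioc.2 hb0
  have hψb : 0 < ψ b :=
    pos_of_mul_rightDeriv_lt hψ hψ_nonneg hψ0 (hb hb').2 (hb hb').1
  refine not_vanishesToInfiniteOrder_of_eventually_mul_pow_le (N := N)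
    (div_pos hψb (pow_pos hb0 N)) ?_ h
  filter_upwards [Ioo_mem_nhdsGT hb0] with a ⟨ha0, hab⟩
  have hIcc : ∀ x ∈ Icc a b, x ∈ Ioc 0 b := fun x hx => ⟨ha0.trans_le hx.1, hx.2⟩
  have hgrowth := le_mul_div_pow_of_mul_deriv_right_lt ha0 hab.le
    (hψ.continuousOn_interior.mono fun x hx => hint x (hIcc x hx))
    (fun x hx => (hψ.hasDerivWithinAt_rightDeriv_of_mem_interior
      (hint x (hIcc x (Ico_subset_Icc_self hx)))).Ici_of_Ioi)
    (fun x hx => (hb (hIcc x (Ico_subset_Icc_self hx))).1)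
  rw [div_mul_eq_mul_div, div_le_iff₀ (pow_pos hb0 N)]
  calc ψ b * a ^ N ≤ ψ a * (b / a) ^ N * a ^ N := by gcongr
    _ = ψ a * b ^ N := by rw [mul_assoc, ← mul_pow, div_mul_cancel₀ b ha0.ne']

end InfiniteOrder

section Convex

theorem lt_apply_of_eventually_nhdsWithin {E : Type*} [NormedAddCommGroup E] [NormedSpace ℝ E]
    {D : Set E} (hopen : IsOpen D) (hconv : Convex ℝ D) {p : E} (hp : p ∈ closure D)
    {l : E →ₗ[ℝ] ℝ} (hl : ∀ᶠ z in 𝓝[D] p, l p < l z) {z : E} (hz : z ∈ D) : l p < l z := by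
  have hseg : ∀ s ∈ Ioo (0 : ℝ) 1, p + s • (z - p) ∈ D := by
    intro s hs
    rw [← hopen.interior_eq]
    exact hconv.openSegment_closure_interior_subset_interior hp (hopen.interior_eq.symm ▸ hz)
      (openSegment_eq_image' ℝ p z ▸ mem_image_of_mem _ hs)
  have htend : Tendsto (fun s : ℝ => p + s • (z - p)) (𝓝[>] 0) (𝓝[D] p) := by
    refine tendsto_nhdsWithin_iff.2 ⟨?_, ?_⟩
    · exact (Continuous.tendsto' (by fun_prop) 0 p (by simp)).mono_left nhdsWithin_le_nhds
    · filter_upwards [Ioo_mem_nhdsGT one_pos] using hseg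
  obtain ⟨s, hlt, hs⟩ := ((htend.eventually hl).and self_mem_nhdsWithin).exists
  rw [map_add, map_smul, map_sub, smul_eq_mul, lt_add_iff_pos_right] at hlt
  exact sub_pos.1 (pos_of_mul_pos_right hlt (mem_Ioi.1 hs).le)

theorem mem_closure_of_eventually_add_smul_mem {E : Type*} [NormedAddCommGroup E]
    [NormedSpace ℝ E] {D : Set E} {x e : E} (h : ∀ᶠ s : ℝ in 𝓝[>] 0, x + s • e ∈ D) :
    x ∈ closure D := by
  have htend : Tendsto (fun s : ℝ => x + s • e) (𝓝[>] 0) (𝓝 x) :=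
    (Continuous.tendsto' (by fun_prop) 0 x (by simp)).mono_left nhdsWithin_le_nhds
  exact mem_closure_of_tendsto htend h

theorem eventually_nhdsGT_mul_lt (c : ℝ) {δ : ℝ} (hδ : 0 < δ) :
    ∀ᶠ a in 𝓝[>] (0 : ℝ), a * c < δ := by
  have htend : Tendsto (fun a => a * c) (𝓝[>] 0) (𝓝 0) :=
    (Continuous.tendsto' (by fun_prop) 0 0 (zero_mul c)).mono_left nhdsWithin_le_nhds
  exact htend.eventually_lt_const hδ

variable {E : Type*} [NormedAddCommGroup E] [NormedSpace ℂ E]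

theorem exists_disc_halfSpace_of_smul_notMem {K : Set E} (hK : IsClosed K)
    (hconv : Convex ℝ K) {e : E} (hnhds : ∀ᶠ η : ℂ in 𝓝 0, η • e ∈ K)
    (hline : ∃ η : ℂ, η • e ∉ K) {θ : ℝ} (hθ : 0 < θ) :
    ∃ (ℓ : E →L[ℂ] ℂ) (c : ℂ) (k : ℝ), (∀ η : ℂ, ‖η‖ ≤ 1 → η • c • e ∈ K) ∧
      (∀ z ∈ K, (ℓ z).re < k) ∧ k < (1 + θ) * (ℓ (c • e)).re := by
  set F : Set ℂ := {η | η • e ∈ K}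
  have hFc : Fᶜ.Nonempty := hline
  have hF : IsClosed F := hK.preimage (by fun_prop)
  set b := Metric.infDist 0 Fᶜ
  have hb : 0 < b := by
    rw [← Metric.infDist_pos_iff_notMem_closure hFc, closure_compl, notMem_compl_iff]
    exact mem_interior_iff_mem_nhds.2 hnhds
  have hdisc : Metric.closedBall 0 b ⊆ F :=
    (Metric.closedBall_infDist_compl_subset_closure (mem_of_mem_nhds hnhds)).trans
      hF.closure_subset
  -- A half-space that contains `K` but not a nearly nearest point of the line outside `K` almost
  -- touches the largest disc around `0` in the line.
  obtain ⟨η₀, hη₀, hlt⟩ :=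
    (Metric.infDist_lt_iff hFc).1 (lt_mul_of_one_lt_left hb (lt_add_of_pos_right 1 hθ))
  rw [dist_zero_left] at hlt
  obtain ⟨ℓ, k, hℓK, hℓ⟩ := RCLike.geometric_hahn_banach_closed_point (𝕜 := ℂ) hconv hK hη₀
  obtain ⟨ω, hω, hων⟩ : ∃ ω : ℂ, ‖ω‖ = 1 ∧ ω * ℓ e = ‖ℓ e‖ := by
    obtain ⟨ω, hω, hων⟩ := Complex.exists_norm_eq_mul_self (ℓ e)
    exact ⟨ω, hω, hων.symm⟩
  have re_apply : (ℓ ((b * ω) • e)).re = b * ‖ℓ e‖ := by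
    rw [map_smul, smul_eq_mul, mul_assoc, hων, ← Complex.ofReal_mul, Complex.ofReal_re]
  refine ⟨ℓ, b * ω, k, fun η hη => ?_, hℓK, ?_⟩
  · rw [smul_smul]
    refine hdisc (mem_closedBall_zero_iff.2 ?_)
    rw [norm_mul, norm_mul, hω, mul_one, Complex.norm_of_nonneg hb.le]
    exact mul_le_of_le_one_left hb.le hη
  · rw [re_apply]
    calc k < (ℓ (η₀ • e)).re := hℓ
      _ ≤ ‖ℓ (η₀ • e)‖ := Complex.re_le_norm _
      _ = ‖η₀‖ * ‖ℓ e‖ := by rw [map_smul, norm_smul]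
      _ ≤ (1 + θ) * b * ‖ℓ e‖ := by gcongr
      _ = (1 + θ) * (b * ‖ℓ e‖) := mul_assoc _ _ _

end Convex

section Existence

variable {E F : Type*} [NormedAddCommGroup E] [NormedSpace ℂ E] [NormedAddCommGroup F]
  [NormedSpace ℂ F] {D : Set E} {f : E →L[ℂ] ℂ} {π : E →L[ℂ] F} {ν : F →L[ℂ] ℂ} {e₀ e₁ p : E}
  {ψ : ℝ → ℝ} {ε m r t x M : ℝ}

theorem mem_closure_of_eventually_mem_iff (hf₀ : f e₀ = 1) (hπ₀ : π e₀ = 0)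
    (hp : ∀ᶠ z in 𝓝 p, z ∈ D ↔ ψ ‖π z‖ < (f z).re) (hfp : (f p).re = ψ ‖π p‖) :
    p ∈ closure D := by
  refine mem_closure_of_eventually_add_smul_mem (e := e₀) ?_
  have htend : Tendsto (fun s : ℝ => p + s • e₀) (𝓝[>] 0) (𝓝 p) :=
    (Continuous.tendsto' (by fun_prop) 0 p (by simp)).mono_left nhdsWithin_le_nhds
  filter_upwards [htend.eventually hp, self_mem_nhdsWithin] with s hs hs0
  rw [hs, ← Complex.coe_smul, map_add, map_add, map_smul, map_smul, hπ₀, hf₀, smul_zero, add_zero,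
    Complex.add_re, hfp, smul_eq_mul, mul_one, Complex.ofReal_re]
  exact lt_add_of_pos_right _ hs0

theorem mul_re_sub_lt_re_sub_of_eventually_mem_iff (hopen : IsOpen D) (hconv : Convex ℝ D)
    (hf₀ : f e₀ = 1) (hπ₀ : π e₀ = 0) (hp : ∀ᶠ z in 𝓝 p, z ∈ D ↔ ψ ‖π z‖ < (f z).re)
    (hfp : (f p).re = ψ ‖π p‖) (hpε : ‖π p‖ < ε) (hm0 : 0 ≤ m)
    (hm : ∀ y ∈ Ico 0 ε, ψ ‖π p‖ + m * (y - ‖π p‖) ≤ ψ y) (hν : ‖ν‖ ≤ 1)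
    (hνp : ν (π p) = ‖π p‖) {z : E} (hz : z ∈ D) :
    m * ((ν (π z)).re - ‖π p‖) < (f z).re - ψ ‖π p‖ := by
  set l : E →ₗ[ℝ] ℝ :=
    Complex.reLm ∘ₗ ((f - (m : ℂ) • ν.comp π).toLinearMap.restrictScalars ℝ)
  have hl : ∀ z, l z = (f z).re - m * (ν (π z)).re := fun z =>
    (Complex.sub_re _ _).trans (congrArg _ (Complex.re_ofReal_mul _ _))
  have hlt : l p < l z := by
    refine lt_apply_of_eventually_nhdsWithin hopen hconv
      (mem_closure_of_eventually_mem_iff hf₀ hπ₀ hp hfp) ?_ hz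
    have hε : ∀ᶠ z in 𝓝 p, ‖π z‖ < ε :=
      (Continuous.tendsto (by fun_prop) p).eventually_lt_const hpε
    filter_upwards [nhdsWithin_le_nhds hp, nhdsWithin_le_nhds hε, self_mem_nhdsWithin]
      with z hzD hzε hz
    have hre : (ν (π z)).re ≤ ‖π z‖ :=
      (Complex.re_le_norm _).trans ((ν.le_of_opNorm_le hν _).trans_eq (one_mul _))
    have hmre : m * (ν (π z)).re ≤ m * ‖π z‖ := mul_le_mul_of_nonneg_left hre hm0
    rw [hl, hl, hνp, hfp, Complex.ofReal_re]
    linarith [hzD.1 hz, hm ‖π z‖ ⟨norm_nonneg _, hzε⟩]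
  rw [hl, hl, hνp, hfp, Complex.ofReal_re] at hlt
  linarith

theorem containsTruncatedProduct_of_disc_subset_closure (hopen : IsOpen D) (hconv : Convex ℝ D)
    (hf₀ : f e₀ = 1) (hball : ∀ z, ‖z‖ < r → 0 < (f z).re → z ∈ D) {v : E}
    (hdisc : ∀ η : ℂ, ‖η‖ ≤ 1 → η • v ∈ closure D) {a θ : ℝ} (hM : 0 < M) (ha : 0 < a)
    (hθ0 : 0 < θ) (hθ1 : θ ≤ 1) (hsmall : a * (M * ‖e₀‖) < θ * r) :
    ContainsTruncatedProduct D M ((a : ℂ) • e₀) ((1 - θ : ℂ) • v) := by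
  intro ζ η hre hζ hη
  have hre0 : 0 < ζ.re := (inv_pos.2 hM).trans_le hre
  have hmem : ((θ⁻¹ * a : ℝ) * ζ) • e₀ ∈ D := by
    refine hball _ ?_ ?_
    · rw [norm_smul, norm_mul, Complex.norm_of_nonneg (by positivity), mul_assoc, mul_assoc,
        inv_mul_lt_iff₀ hθ0]
      exact lt_of_le_of_lt (by gcongr) hsmall
    · rw [map_smul, hf₀, smul_eq_mul, mul_one, Complex.re_ofReal_mul]
      positivity
  have hcombo := hconv.combo_interior_closure_mem_interior (hopen.interior_eq.symm ▸ hmem)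
    (hdisc η hη.le) hθ0 (sub_nonneg.2 hθ1) (add_sub_cancel _ _)
  rw [hopen.interior_eq] at hcombo
  convert hcombo using 1
  have : (θ : ℂ) ≠ 0 := Complex.ofReal_ne_zero.2 hθ0.ne'
  rw [← Complex.coe_smul θ, ← Complex.coe_smul (1 - θ), smul_smul, smul_smul, smul_smul, smul_smul]
  push_cast
  congr 2
  · field_simp
  · ring

theorem mem_closure_of_eventually_pos_re_mem (hf₀ : f e₀ = 1) (hf₁ : f e₁ = 0)
    (hflat : ∀ᶠ z in 𝓝 0, 0 < (f z).re → z ∈ D) : ∀ᶠ η : ℂ in 𝓝 0, η • e₁ ∈ closure D := by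
  have htend : Tendsto (fun η : ℂ => η • e₁) (𝓝 0) (𝓝 0) :=
    Continuous.tendsto' (by fun_prop) 0 0 (zero_smul ℂ e₁)
  filter_upwards [htend.eventually hflat.eventually_nhds] with η hη
  refine mem_closure_of_eventually_add_smul_mem (e := e₀) ?_
  have htend' : Tendsto (fun s : ℝ => η • e₁ + s • e₀) (𝓝[>] 0) (𝓝 (η • e₁)) :=
    (Continuous.tendsto' (by fun_prop) 0 _ (by simp)).mono_left nhdsWithin_le_nhds
  filter_upwards [htend'.eventually hη, self_mem_nhdsWithin] with s hs hs0
  refine hs ?_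
  rw [← Complex.coe_smul, map_add, map_smul, map_smul, hf₁, hf₀, smul_zero, zero_add, smul_eq_mul,
    mul_one, Complex.ofReal_re]
  exact hs0

theorem exp_mul_sub_le_of_lt_one_add_mul {θ k A B : ℝ} (hθ0 : 0 < θ)
    (hθ1 : θ ≤ 1 / 16) (hθexp : Real.exp (4 * t) * θ = 1 / 16) (hBk : B < k)
    (hkB : k < (1 + θ) * B) (hA : |A| ≤ θ * B) :
    Real.exp (4 * t) * (k - (A + Real.tanh (2 * t) * ((1 - θ) * B))) ≤ 3 * (k - A) := by
  have hB : 0 < B := by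
    have : 0 < θ * B := by linarith
    exact pos_of_mul_pos_right this hθ0.le
  obtain ⟨hA_ge, hA_le⟩ := abs_le.1 hA
  have htanh : Real.tanh (2 * t) * (θ * B) ≤ θ * B :=
    mul_le_of_le_one_left (mul_pos hθ0 hB).le (Real.tanh_lt_one _).le
  have hexp : Real.exp (4 * t) * (1 - Real.tanh (2 * t)) ≤ 2 := by
    convert exp_mul_one_sub_tanh_le (2 * t) using 3
    ring
  have hθB : θ * B ≤ 1 / 16 * B := mul_le_mul_of_nonneg_right hθ1 hB.le
  calc Real.exp (4 * t) * (k - (A + Real.tanh (2 * t) * ((1 - θ) * B)))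
      ≤ Real.exp (4 * t) * ((1 - Real.tanh (2 * t)) * B + 3 * (θ * B)) := by
        gcongr
        linarith
    _ = (Real.exp (4 * t) * (1 - Real.tanh (2 * t))) * B + 3 * (Real.exp (4 * t) * θ) * B := by
        ring
    _ ≤ 2 * B + 3 * (1 / 16) * B := by
        rw [hθexp]
        gcongr
    _ ≤ 3 * (k - A) := by linarith

theorem isAlmostProduct_of_halfSpace (hopen : IsOpen D) (hconv : Convex ℝ D) (hf₀ : f e₀ = 1)
    (hball : ∀ z, ‖z‖ < r → 0 < (f z).re → z ∈ D) {v : E} (hfv : f v = 0)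
    (hdisc : ∀ η : ℂ, ‖η‖ ≤ 1 → η • v ∈ closure D) {ℓ : E →L[ℂ] ℂ} {k a θ : ℝ}
    (hℓ : ∀ z ∈ closure D, (ℓ z).re < k) (hM : 0 < M) (ha : 0 < a) (hθ0 : 0 < θ)
    (hθ1 : θ ≤ 1 / 16) (hθexp : Real.exp (4 * t) * θ = 1 / 16)
    (hsmall : a * (M * ‖e₀‖) < θ * r) (hkv : k < (1 + θ) * (ℓ v).re)
    (hA : a * |(ℓ e₀).re| ≤ θ * (ℓ v).re) :
    IsAlmostProduct D f (fun z => k - ℓ z) ((a : ℂ) • e₀) ((1 - θ : ℂ) • v) t M := by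
  have hv : (ℓ v).re < k := by simpa only [one_smul] using hℓ _ (hdisc 1 norm_one.le)
  have re_u : (ℓ ((a : ℂ) • e₀)).re = a * (ℓ e₀).re := by
    rw [map_smul, smul_eq_mul, Complex.re_ofReal_mul]
  have re_v : (ℓ ((Real.tanh (2 * t) : ℂ) • (1 - θ : ℂ) • v)).re =
      Real.tanh (2 * t) * ((1 - θ) * (ℓ v).re) := by
    rw [map_smul, map_smul, smul_eq_mul, smul_eq_mul, Complex.re_ofReal_mul, ← Complex.ofReal_one,
      ← Complex.ofReal_sub, Complex.re_ofReal_mul]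
  refine ⟨?_, ?_, by fun_prop, fun z hz => ?_, ?_⟩
  · rw [map_smul, hfv, smul_zero]
  · exact containsTruncatedProduct_of_disc_subset_closure hopen hconv hf₀ hball hdisc hM ha hθ0
      (by linarith) hsmall
  · rw [Complex.sub_re, Complex.ofReal_re]
    exact sub_pos.2 (hℓ z (subset_closure hz))
  · rw [Complex.sub_re, Complex.sub_re, map_add, Complex.add_re, re_u, re_v, Complex.ofReal_re]
    refine exp_mul_sub_le_of_lt_one_add_mul hθ0 hθ1 hθexp hv hkv ?_
    rwa [abs_mul, abs_of_pos ha]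

theorem exists_isAlmostProduct_of_flat (hopen : IsOpen D) (hconv : Convex ℝ D) (hf₀ : f e₀ = 1)
    (hf₁ : f e₁ = 0) (hline : ∃ η : ℂ, η • e₁ ∉ closure D)
    (hflat : ∀ᶠ z in 𝓝 0, 0 < (f z).re → z ∈ D) (ht : 0 < t) (hM : 0 < M) :
    ∃ (g : E → ℂ) (u v : E), IsAlmostProduct D f g u v t M := by
  obtain ⟨r, hr, hball⟩ := Metric.eventually_nhds_iff.1 hflat
  simp only [dist_zero_right] at hball
  set θ := Real.exp (-(4 * t)) / 16 with hθ_def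
  have hθ0 : 0 < θ := by positivity
  have hθ1 : θ ≤ 1 / 16 := by
    have : Real.exp (-(4 * t)) ≤ 1 := Real.exp_le_one_iff.2 (by linarith)
    linarith
  have hθexp : Real.exp (4 * t) * θ = 1 / 16 := by
    rw [hθ_def, ← mul_div_assoc, ← Real.exp_add, add_neg_cancel, Real.exp_zero]
  obtain ⟨ℓ, c, k, hdisc, hℓ, hkv⟩ := exists_disc_halfSpace_of_smul_notMem isClosed_closure
    hconv.closure (mem_closure_of_eventually_pos_re_mem hf₀ hf₁ hflat) hline hθ0
  have hv : (ℓ (c • e₁)).re < k := by simpa only [one_smul] using hℓ _ (hdisc 1 norm_one.le)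
  have hpos : 0 < θ * (ℓ (c • e₁)).re := by linarith
  obtain ⟨a, hsmall, hA, ha⟩ := ((eventually_nhdsGT_mul_lt (M * ‖e₀‖) (mul_pos hθ0 hr)).and
    ((eventually_nhdsGT_mul_lt |(ℓ e₀).re| hpos).and self_mem_nhdsWithin)).exists
  have hfv : f (c • e₁) = 0 := by rw [map_smul, hf₁, smul_zero]
  exact ⟨_, _, _, isAlmostProduct_of_halfSpace hopen hconv hf₀ hball hfv hdisc hℓ hM ha hθ0 hθ1
    hθexp hsmall hkv hA.le⟩

theorem containsTruncatedProduct_of_forall_mul_lt (hf₀ : f e₀ = 1) (hf₁ : f e₁ = 0)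
    (hπ₀ : π e₀ = 0) (hπ₁ : ‖π e₁‖ = 1) (hnear : ∀ z, ‖z‖ < r → ψ ‖π z‖ < (f z).re → z ∈ D)
    {a : ℝ} (ha : 0 < a) (hx : 0 < x) (hM : 0 < M) (hψ : ∀ y ∈ Icc 0 x, M * ψ y < a)
    (hsmall : a * (M * ‖e₀‖) + x * ‖e₁‖ < r) :
    ContainsTruncatedProduct D M ((a : ℂ) • e₀) ((x : ℂ) • e₁) := by
  intro ζ η hre hζ hη
  have hηx : ‖η‖ * x ≤ x := mul_le_of_le_one_left hx.le hη.le
  refine hnear _ ?_ ?_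
  · calc ‖ζ • (a : ℂ) • e₀ + η • (x : ℂ) • e₁‖
        ≤ ‖ζ • (a : ℂ) • e₀‖ + ‖η • (x : ℂ) • e₁‖ := norm_add_le _ _
      _ = a * (‖ζ‖ * ‖e₀‖) + ‖η‖ * x * ‖e₁‖ := by
          rw [norm_smul, norm_smul, norm_smul, norm_smul, Complex.norm_of_nonneg ha.le,
            Complex.norm_of_nonneg hx.le, mul_left_comm, mul_assoc]
      _ ≤ a * (M * ‖e₀‖) + x * ‖e₁‖ := by gcongr
      _ < r := hsmall
  · simp only [map_add, map_smul, hf₀, hf₁, hπ₀, smul_zero, zero_add, add_zero, smul_eq_mul,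
      mul_one, mul_zero, norm_smul, hπ₁, Complex.norm_of_nonneg hx.le, Complex.re_mul_ofReal]
    calc ψ (‖η‖ * x) < M⁻¹ * a :=
          (lt_inv_mul_iff₀ hM).2 (hψ _ ⟨mul_nonneg (norm_nonneg η) hx.le, hηx⟩)
      _ ≤ ζ.re * a := by gcongr

theorem isAlmostProduct_of_tangent (hf₀ : f e₀ = 1) (hf₁ : f e₁ = 0) (hπ₀ : π e₀ = 0)
    (hπ₁ : ‖π e₁‖ = 1) (hνπ : ν (π e₁) = 1)
    (hnear : ∀ z, ‖z‖ < r → ψ ‖π z‖ < (f z).re → z ∈ D) {a : ℝ} (ha : 0 < a) (hx : 0 < x)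
    (hM : 0 < M) (hψ : ∀ y ∈ Icc 0 x, M * ψ y < a) (hsmall : a * (M * ‖e₀‖) + x * ‖e₁‖ < r)
    (hsupp : ∀ z ∈ D, m * ((ν (π z)).re - x) < (f z).re - ψ x) (hψ0 : 0 ≤ ψ x) (hψa : ψ x ≤ a)
    (horder : Real.exp (4 * t) * a ≤ m * x) :
    IsAlmostProduct D f (fun z => (m * x - ψ x : ℝ) + (f z - m * ν (π z))) ((a : ℂ) • e₀)
      ((x : ℂ) • e₁) t M := by
  refine ⟨by rw [map_smul, hf₁, smul_zero],
    containsTruncatedProduct_of_forall_mul_lt hf₀ hf₁ hπ₀ hπ₁ hnear ha hx hM hψ hsmall,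
    by fun_prop, fun z hz => ?_, ?_⟩
  · have := hsupp z hz
    rw [Complex.add_re, Complex.ofReal_re, Complex.sub_re, Complex.re_ofReal_mul]
    linarith
  · simp only [map_add, map_smul, hf₀, hf₁, hπ₀, hνπ, smul_eq_mul, mul_one, mul_zero, zero_add,
      add_zero, map_zero, smul_zero, Complex.add_re, Complex.sub_re, Complex.re_ofReal_mul,
      Complex.ofReal_re, sub_zero]
    have hmx : 0 ≤ m * x := (by positivity : 0 ≤ Real.exp (4 * t) * a).trans horder
    have hexp : Real.exp (4 * t) * (1 - Real.tanh (2 * t)) ≤ 2 := by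
      convert exp_mul_one_sub_tanh_le (2 * t) using 3
      ring
    calc Real.exp (4 * t) * (m * x - ψ x + (a - m * (Real.tanh (2 * t) * x)))
        ≤ Real.exp (4 * t) * (m * x * (1 - Real.tanh (2 * t)) + a) := by
          refine mul_le_mul_of_nonneg_left ?_ (Real.exp_nonneg _)
          linarith
      _ = Real.exp (4 * t) * (1 - Real.tanh (2 * t)) * (m * x) + Real.exp (4 * t) * a := by ring
      _ ≤ 2 * (m * x) + m * x := by gcongr
      _ ≤ 3 * (m * x - ψ x + a) := by linarith

theorem mul_re_sub_lt_re_sub_of_subgradient (hopen : IsOpen D) (hconv : Convex ℝ D)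
    (hf₀ : f e₀ = 1) (hf₁ : f e₁ = 0) (hπ₀ : π e₀ = 0) (hπ₁ : ‖π e₁‖ = 1) (hν : ‖ν‖ ≤ 1)
    (hνπ : ν (π e₁) = 1)
    (hp : ∀ᶠ z in 𝓝 (ψ x • e₀ + x • e₁), z ∈ D ↔ ψ ‖π z‖ < (f z).re) (hx : x ∈ Ico 0 ε)
    (hm0 : 0 ≤ m) (hm : ∀ y ∈ Ico 0 ε, ψ x + m * (y - x) ≤ ψ y) {z : E} (hz : z ∈ D) :
    m * ((ν (π z)).re - x) < (f z).re - ψ x := by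
  have hπp : π (ψ x • e₀ + x • e₁) = (x : ℂ) • π e₁ := by
    simp only [← Complex.coe_smul, map_add, map_smul, hπ₀, smul_zero, zero_add]
  have norm_πp : ‖π (ψ x • e₀ + x • e₁)‖ = x := by
    rw [hπp, norm_smul, hπ₁, mul_one, Complex.norm_of_nonneg hx.1]
  have hνp : ν (π (ψ x • e₀ + x • e₁)) = x := by
    rw [hπp, map_smul, hνπ, smul_eq_mul, mul_one]
  have hfp : (f (ψ x • e₀ + x • e₁)).re = ψ x := by
    simp only [← Complex.coe_smul, map_add, map_smul, hf₀, hf₁, smul_eq_mul, mul_one, mul_zero,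
      add_zero, Complex.ofReal_re]
  have := mul_re_sub_lt_re_sub_of_eventually_mem_iff (ε := ε) (m := m) (ν := ν) hopen hconv hf₀ hπ₀
    hp
  simp only [norm_πp, hfp, hνp] at this
  exact this trivial hx.2 hm0 hm hν trivial hz

theorem eventually_nhdsGT_mul_add_mul_lt (hψ : Tendsto ψ (𝓝[>] 0) (𝓝 0)) (c d : ℝ) (hr : 0 < r) :
    ∀ᶠ x in 𝓝[>] 0, ψ x * c + x * d < r := by
  have id_tendsto : Tendsto id (𝓝[>] (0 : ℝ)) (𝓝 0) := tendsto_id.mono_left nhdsWithin_le_nhds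
  have := (hψ.mul_const c).add (id_tendsto.mul_const d)
  rw [zero_mul, zero_mul, add_zero] at this
  exact this.eventually_lt_const hr

theorem tendsto_smul_add_smul_nhdsGT_zero (hψ : Tendsto ψ (𝓝[>] 0) (𝓝 0)) (e₀ e₁ : E) :
    Tendsto (fun x => ψ x • e₀ + x • e₁) (𝓝[>] 0) (𝓝 0) := by
  have id_tendsto : Tendsto id (𝓝[>] (0 : ℝ)) (𝓝 0) := tendsto_id.mono_left nhdsWithin_le_nhds
  simpa only [zero_smul, add_zero, id] using (hψ.smul_const e₀).add (id_tendsto.smul_const e₁)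

theorem exists_isAlmostProduct_of_vanishesToInfiniteOrder (hopen : IsOpen D) (hconv : Convex ℝ D)
    (hf₀ : f e₀ = 1) (hf₁ : f e₁ = 0) (hπ₀ : π e₀ = 0) (hπ₁ : ‖π e₁‖ = 1) (hε : 0 < ε)
    (hψ : ConvexOn ℝ (Ico 0 ε) ψ) (hψ_nonneg : ∀ x ∈ Ico 0 ε, 0 ≤ ψ x) (hψ0 : ψ 0 = 0)
    (hpos : ∀ x ∈ Ioo 0 ε, 0 < ψ x) (horder : VanishesToInfiniteOrder ψ)
    (hD : ∀ᶠ z in 𝓝 0, z ∈ D ↔ ψ ‖π z‖ < (f z).re) (hM : 1 < M) :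
    ∃ (g : E → ℂ) (u v : E), IsAlmostProduct D f g u v t M := by
  obtain ⟨r, hr, hnear⟩ := Metric.eventually_nhds_iff.1 hD
  simp only [dist_zero_right] at hnear
  obtain ⟨N, hN⟩ := exists_nat_ge (Real.exp (4 * t) * (2 * M))
  obtain ⟨ν, hν, hνπ⟩ : ∃ ν : F →L[ℂ] ℂ, ‖ν‖ ≤ 1 ∧ ν (π e₁) = 1 := by
    simpa only [hπ₁, map_one] using exists_dual_vector'' ℂ (π e₁)
  have htend : Tendsto ψ (𝓝[>] 0) (𝓝 0) := tendsto_nhdsGT_zero_of_convexOn hε hψ hψ_nonneg hψ0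
  obtain ⟨x, horder_x, hsmall, hp, hx⟩ :=
    ((horder.frequently_mul_le_mul_rightDeriv hε hψ hψ_nonneg hψ0 N).and_eventually
      ((eventually_nhdsGT_mul_add_mul_lt htend (2 * M * (M * ‖e₀‖)) ‖e₁‖ hr).and
        (((tendsto_smul_add_smul_nhdsGT_zero htend e₀ e₁).eventually hD.eventually_nhds).and
          (Ioo_mem_nhdsGT hε)))).exists
  set m := derivWithin ψ (Ioi x) x
  have hψx : 0 < ψ x := hpos x hx
  have hMx : ψ x < M * ψ x := lt_mul_of_one_lt_left hψx hM
  have hNx : Real.exp (4 * t) * (2 * M * ψ x) ≤ m * x := by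
    calc Real.exp (4 * t) * (2 * M * ψ x) = Real.exp (4 * t) * (2 * M) * ψ x := by ring
      _ ≤ N * ψ x := by gcongr
      _ ≤ m * x := horder_x.trans_eq (mul_comm _ _)
  have hm : 0 ≤ m := nonneg_of_mul_nonneg_left
    ((by positivity : 0 ≤ Real.exp (4 * t) * (2 * M * ψ x)).trans hNx) hx.1
  have hsubgrad : ∀ y ∈ Ico 0 ε, ψ x + m * (y - x) ≤ ψ y := fun y hy =>
    add_rightDeriv_mul_sub_le hψ (by rwa [interior_Ico]) hy
  refine ⟨_, _, _, isAlmostProduct_of_tangent (a := 2 * M * ψ x) hf₀ hf₁ hπ₀ hπ₁ hνπ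
    (fun z hz => (hnear hz).2) (by positivity) hx.1 (by positivity) (fun y hy => ?_) ?_
    (fun z hz => mul_re_sub_lt_re_sub_of_subgradient hopen hconv hf₀ hf₁ hπ₀ hπ₁ hν hνπ hp
      (Ioo_subset_Ico_self hx) hm hsubgrad hz)
    hψx.le (by linarith) hNx⟩
  · have : ψ y ≤ ψ x := le_of_convexOn_of_map_zero hψ hψ0 hψx.le hy.1 hy.2 hx.1 hx.2
    calc M * ψ y ≤ M * ψ x := by gcongr
      _ < 2 * M * ψ x := by linarith
  · convert hsmall using 2
    ring

end Existence

section NotGromovHyperbolic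

variable {E F : Type*} [NormedAddCommGroup E] [NormedSpace ℂ E] [NormedAddCommGroup F]
  [NormedSpace ℂ F] {D : Set E}

theorem exists_smul_notMem_closure_of_isBounded (hD : Bornology.IsBounded D) {e : E} (he : e ≠ 0) :
    ∃ η : ℂ, η • e ∉ closure D := by
  obtain ⟨R, hR⟩ := hD.closure.exists_norm_le
  obtain ⟨η, hη⟩ := NormedField.exists_lt_norm ℂ (R / ‖e‖)
  refine ⟨η, fun hmem => (hR _ hmem).not_gt ?_⟩
  rwa [norm_smul, ← div_lt_iff₀ (norm_pos_iff.2 he)]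

theorem eventually_pos_re_mem_of_eq_zero {f : E →L[ℂ] ℂ} {π : E →L[ℂ] F} {ψ : ℝ → ℝ} {ε x : ℝ}
    (hψ : ConvexOn ℝ (Ico 0 ε) ψ) (hψ0 : ψ 0 = 0) (hx : x ∈ Ioo 0 ε) (hψx : ψ x ≤ 0)
    (hD : ∀ᶠ z in 𝓝 0, z ∈ D ↔ ψ ‖π z‖ < (f z).re) : ∀ᶠ z in 𝓝 0, 0 < (f z).re → z ∈ D := by
  have hπ : ∀ᶠ z in 𝓝 0, ‖π z‖ < x :=
    (Continuous.tendsto' (by fun_prop) 0 0 (by simp)).eventually_lt_const hx.1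
  filter_upwards [hD, hπ] with z hzD hπz hfz
  have : ψ ‖π z‖ ≤ ‖π z‖ / x * ψ x :=
    le_div_mul_of_convexOn_of_map_zero hψ hψ0 (norm_nonneg _) hπz.le hx.1 hx.2
  have : ‖π z‖ / x * ψ x ≤ 0 :=
    mul_nonpos_of_nonneg_of_nonpos (div_nonneg (norm_nonneg _) hx.1.le) hψx
  exact hzD.2 (by linarith)

theorem theorem2_general (hopen : IsOpen D) (hconv : Convex ℝ D) {f : E →L[ℂ] ℂ} {π : E →L[ℂ] F}
    {e₀ e₁ : E} (hf₀ : f e₀ = 1) (hf₁ : f e₁ = 0) (hπ₀ : π e₀ = 0) (hπ₁ : ‖π e₁‖ = 1)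
    (hline : ∃ η : ℂ, η • e₁ ∉ closure D) {ψ : ℝ → ℝ} {ε : ℝ} (hε : 0 < ε)
    (hψ : ConvexOn ℝ (Ico 0 ε) ψ) (hψ_nonneg : ∀ x ∈ Ico 0 ε, 0 ≤ ψ x) (hψ0 : ψ 0 = 0)
    (hψ_order : VanishesToInfiniteOrder ψ) (hD : ∀ᶠ z in 𝓝 0, z ∈ D ↔ -(f z).re + ψ ‖π z‖ < 0) :
    ¬ IsGromovHyperbolicOn D (kobayashiDist D) := by
  simp only [neg_add_lt_iff_lt_add, add_zero] at hD
  have hf_pos : ∀ z ∈ D, 0 < (f z).re := by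
    intro z hz
    have := mul_re_sub_lt_re_sub_of_eventually_mem_iff (p := 0) (ε := ε) (m := 0) (ν := 0) hopen
      hconv hf₀ hπ₀ hD
    simp only [map_zero, norm_zero, hψ0, Complex.zero_re, Complex.ofReal_zero, zero_mul, zero_add,
      sub_zero] at this
    exact this trivial hε le_rfl hψ_nonneg zero_le_one trivial hz
  refine not_isGromovHyperbolicOn_of_isAlmostProduct hf_pos fun t M ht hM => ?_
  by_cases hpos : ∀ x ∈ Ioo 0 ε, 0 < ψ x
  · exact exists_isAlmostProduct_of_vanishesToInfiniteOrder hopen hconv hf₀ hf₁ hπ₀ hπ₁ hε hψ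
      hψ_nonneg hψ0 hpos hψ_order hD hM
  · push Not at hpos
    obtain ⟨x, hx, hψx⟩ := hpos
    exact exists_isAlmostProduct_of_flat hopen hconv hf₀ hf₁ hline
      (eventually_pos_re_mem_of_eq_zero hψ hψ0 hx hψx hD) ht (one_pos.trans hM)

end NotGromovHyperbolic

theorem theorem2 (D : Set (EuclideanSpace ℂ (Fin 2))) (hD_open : IsOpen D)
    (hD_conv : Convex ℝ D) (hD_bdd : Bornology.IsBounded D) (hD_smooth : HasC11Boundary D)
    (ψ : ℝ → ℝ) (ε : ℝ) (hε : 0 < ε)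
    (hψ_smooth : IsC11On ψ (Ioo (-ε) ε)) (hψ_conv : ConvexOn ℝ (Ioo (-ε) ε) ψ)
    (hψ_nonneg : ∀ x ∈ Ioo (-ε) ε, 0 ≤ ψ x) (hψ_zero : ψ 0 = 0)
    (hψ_order : VanishesToInfiniteOrder ψ)
    (hD_def : ∀ᶠ z in 𝓝 (0 : EuclideanSpace ℂ (Fin 2)), z ∈ D ↔ -(z 0).re + ψ ‖z 1‖ < 0) :
    ¬ IsGromovHyperbolicOn D (kobayashiDist D) := by
  have hsub : Ico 0 ε ⊆ Ioo (-ε) ε := fun x hx => ⟨(neg_lt_zero.2 hε).trans_le hx.1, hx.2⟩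
  exact theorem2_general (f := EuclideanSpace.proj 0) (π := EuclideanSpace.proj 1)
    (e₀ := EuclideanSpace.single 0 1) (e₁ := EuclideanSpace.single 1 1) hD_open hD_conv (by simp)
    (by simp) (by simp) (by simp) (exists_smul_notMem_closure_of_isBounded hD_bdd (by simp)) hε
    (hψ_conv.subset hsub (convex_Ico 0 ε)) (fun x hx => hψ_nonneg x (hsub hx)) hψ_zero hψ_order
    hD_def
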